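/- A \emph{Souslin space} is a Hausdorff topological space that is the image of a Polish space under a continuous map. Let $X$ and $Y$ be compact Souslin spaces, let $c : X\times Y\to[0,+\infty)$ be continuous, let $n\ge 1$, let $\mu_1,\dots,\mu_n$ be atomless Borel probability measures on $X$, and let $\nu$ be an atomless Borel probability measure on $Y$. Put $\mu:=\frac1n(\mu_1+\dots+\mu_n)$. Let $\Pi(\mu,\nu)$ be the set of Borel measures $\pi$ on $X\times Y$ with $\pi(A\times Y)=\mu(A)$ and $\pi(X\times B)=\nu(B)$ for all Borel sets $A\subset X$ and $B\subset Y$. For $\pi\in\Pi(\mu,\nu)$ let $(\pi^x)_{x\in X}$ denote the conditional probability measures of $\pi$ on $Y$ with respect to $\mu$, that is, $\pi(dx\,dy)=\mu(dx)\,\pi^x(dy)$. Set $$\Pi(\overline{\mu},\nu):=\Bigl\{\pi\in\Pi(\mu,\nu)\;:\;\int_X \pi^x(B)\,d\mu_i(x)=\nu(B)\ \text{ for all } 1\le i\le n \text{ and all Borel } B\subset Y\Bigr\},$$ $$\mathcal{T}(\overline{\mu},\nu):=\bigl\{T:X\to Y \text{ Borel}\;:\;\mu_i\circ T^{-1}=\nu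 \ \text{ for all } 1\le i\le n\bigr\}.$$ Then the minimum on the left below is attained, both sides are finite, and $$\min_{\pi\in\Pi(\overline{\mu},\nu)}\int_{X\times Y} c(x,y)\,d\pi(x,y)\;=\;\inf_{T\in\mathcal{T}(\overline{\mu},\nu)}\int_X c(x,T(x))\,d\mu(x).$$ -/

import Mathlib

open MeasureTheory ProbabilityTheory Set
open scoped NNReal ENNReal

/-- A Souslin space: a Hausdorff space that is the image of a Polish space under a continuous map
(Mathlib's `AnalyticSet`; see `MeasureTheory.analyticSet_iff_exists_polishSpace_range`). -/
class SouslinSpace (X : Type*) [TopologicalSpace X] : Prop extends T2Space X where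
  analyticSet_univ : AnalyticSet (univ : Set X)

namespace SimultaneousOT

variable {X Y : Type*} [MeasurableSpace X] [MeasurableSpace Y]

/-- A measure is atomless if every measurable set of positive measure contains a measurable subset of
strictly smaller positive measure. -/
def Atomless (μ : Measure X) : Prop :=
  ∀ A : Set X, MeasurableSet A → 0 < μ A → ∃ B ⊆ A, MeasurableSet B ∧ 0 < μ B ∧ μ B < μ A

/-- The average `(μ₁ + ⋯ + μₙ) / n`. -/
noncomputable def avg {n : ℕ} (μ : Fin n → Measure X) : Measure X :=
  (n : ℝ≥0∞)⁻¹ • ∑ i, μ i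

/-- The set `Π(μ, ν)` of transport plans: measures on `X × Y` with marginals `μ` and `ν`. -/
def couplings (μ : Measure X) (ν : Measure Y) : Set (Measure (X × Y)) :=
  {π | (∀ A : Set X, MeasurableSet A → π (A ×ˢ univ) = μ A) ∧
    ∀ B : Set Y, MeasurableSet B → π (univ ×ˢ B) = ν B}

/-- The kernel `κ` is a family of conditional probabilities `x ↦ π^x` of `π` with respect to the
measure `μ` on the first factor: `π(dx, dy) = μ(dx) π^x(dy)`. -/
def IsConditional (π : Measure (X × Y)) (μ : Measure X) (κ : Kernel X Y) : Prop :=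
  IsMarkovKernel κ ∧
    ∀ (A : Set X) (B : Set Y), MeasurableSet A → MeasurableSet B →
      π (A ×ˢ B) = ∫⁻ x in A, κ x B ∂μ

/-- The set `Π(μ̄, ν)` of simultaneous transport plans: couplings `π` of the average of the `μ i`
with `ν` such that `∫ π^x(B) dμᵢ = ν(B)` for all `i` and all measurable `B`. The value of the
integral does not depend on the version of `x ↦ π^x(B)`, as each `μ i` is absolutely continuous
with respect to the average. -/
def plans {n : ℕ} (μ : Fin n → Measure X) (ν : Measure Y) : Set (Measure (X × Y)) :=
  {π | π ∈ couplings (avg μ) ν ∧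
    ∃ κ : Kernel X Y, IsConditional π (avg μ) κ ∧
      ∀ (i : Fin n) (B : Set Y), MeasurableSet B → ∫⁻ x, κ x B ∂(μ i) = ν B}

/-- The set `𝒯(μ̄, ν)` of measurable maps `T : X → Y` with `μᵢ ∘ T⁻¹ = ν` for all `i`. -/
def transportMaps {n : ℕ} (μ : Fin n → Measure X) (ν : Measure Y) : Set (X → Y) :=
  {T | Measurable T ∧ ∀ i, (μ i).map T = ν}

/-- The Kantorovich functional `∫ c(x, y) dπ`. -/
noncomputable def kantorovichCost (c : X × Y → ℝ≥0) (π : Measure (X × Y)) : ℝ≥0∞ :=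
  ∫⁻ p, (c p : ℝ≥0∞) ∂π

/-- The Monge functional `∫ c(x, T(x)) dμ`, where `μ` is the average of the `μ i`. -/
noncomputable def mongeCost {n : ℕ} (c : X × Y → ℝ≥0) (μ : Fin n → Measure X) (T : X → Y) :
    ℝ≥0∞ :=
  ∫⁻ x, (c (x, T x) : ℝ≥0∞) ∂(avg μ)

end SimultaneousOT

/-!
# Simultaneous optimal transport: the Monge infimum equals the Kantorovich minimum

A compact Souslin space is second countable (`SouslinSpace.secondCountableTopology`), so both spaces
are compact metrizable and the usual tools (disintegration, weak compactness) are available.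

*The minimum.* In terms of the densities `ρᵢ = dμᵢ/dμ`, a measure `π` with first marginal `μ` is a
simultaneous plan if and only if each `ρᵢ(x) π(dx, dy)` has second marginal `ν`
(`SimultaneousOT.mem_plans_iff`). As `ρᵢ` is an `L¹(μ)`-limit of continuous functions and the first
marginal is fixed, this is a weakly closed condition (`isClosed_setOf_map_snd_withDensity_eq`), so
the plans form a compact set, on which the cost is continuous.

*Approximation of a plan by maps.* A map induces a plan of the same cost, so it remains to
approximate a plan `π(dx, dy) = μ(dx) πˣ(dy)`. Cut `X` and `Y` into finitely many cells `Aⱼ`, `Bₗ`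
on whose products the cost is nearly constant. The Dvoretzky–Wald–Wolfowitz theorem
(`SimultaneousOT.exists_measurable_label`) replaces the probability vector `(πˣ(Bₗ))ₗ` by a label
`L(x)` such that `μᵢ(Aⱼ ∩ {L = l}) = ∫_{Aⱼ} πˣ(Bₗ) dμᵢ` for all `i`, `j`, `l`. In particular
`μᵢ(L = l) = ν(Bₗ)` for every `i`, so all the restrictions of the `μᵢ` to `{L = l}` can be sent to
`ν|_{Bₗ}` by one map (`SimultaneousOT.exists_measurable_map_eq_of_atomless`). Gluing these maps gives
a simultaneous transport map whose cost is close to that of `π`.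

*Both tools* come from Lyapunov's theorem
(`SimultaneousOT.exists_measurableSet_measure_eq_lintegral`): the functions with values in `[0, 1]`
and prescribed integrals against finitely many atomless measures form a weakly compact convex set,
whose extreme points are indicator functions, since a function that is fractional on a charged set
can be perturbed there in both directions without changing finitely many integrals. The label is
obtained by merging two labels, applying induction with additional measures that remember how to
split them, and splitting by Lyapunov's theorem. The common map is obtained by halving cells
repeatedly, which gives a sequence of coin tosses with the same law under all the measures; this law
is atomless, hence can be mapped to any law on a standard Borel space.
-/

/-! ### Compact Souslin spaces are Polish -/

/-- A compact Souslin space has a countable base. Pairs of members of a countable base of the Polish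
parametrisation whose images have disjoint closures give countably many Urysohn functions, and these
separate points. -/
theorem SouslinSpace.secondCountableTopology (X : Type*) [TopologicalSpace X] [CompactSpace X]
    [SouslinSpace X] : SecondCountableTopology X := by
  obtain ⟨P, _, _, f, hf, hrange⟩ :=
    analyticSet_iff_exists_polishSpace_range.1 (SouslinSpace.analyticSet_univ (X := X))
  have hsurj : Function.Surjective f := range_eq_univ.1 hrange
  let b := TopologicalSpace.countableBasis P
  have hb : TopologicalSpace.IsTopologicalBasis b := TopologicalSpace.isBasis_countableBasis P
  let I := {p : b × b // Disjoint (closure (f '' p.1.1)) (closure (f '' p.2.1))}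
  have hI (p : I) : ∃ g : C(X, ℝ), EqOn g 0 (closure (f '' p.1.1.1)) ∧
      EqOn g 1 (closure (f '' p.1.2.1)) := by
    obtain ⟨g, h0, h1, -⟩ := exists_continuous_zero_one_of_isClosed isClosed_closure
      isClosed_closure p.2
    exact ⟨g, h0, h1⟩
  choose g hg0 hg1 using hI
  have hcont : Continuous fun x (p : I) => g p x := by fun_prop
  have hinj : Function.Injective fun x (p : I) => g p x := by
    intro x y hxy
    by_contra hne
    obtain ⟨U, hxU, hU, V, hyV, hV, hUV⟩ := exists_open_nhds_disjoint_closure hne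
    obtain ⟨p, rfl⟩ := hsurj x
    obtain ⟨q, rfl⟩ := hsurj y
    obtain ⟨u, hub, hpu, hu⟩ := hb.exists_subset_of_mem_open hxU (hU.preimage hf)
    obtain ⟨v, hvb, hqv, hv⟩ := hb.exists_subset_of_mem_open hyV (hV.preimage hf)
    have hd : Disjoint (closure (f '' u)) (closure (f '' v)) :=
      hUV.mono (closure_mono (image_subset_iff.2 hu)) (closure_mono (image_subset_iff.2 hv))
    have h := congrFun hxy (⟨(⟨u, hub⟩, ⟨v, hvb⟩), hd⟩ : I)
    simp only at h
    rw [hg0 ⟨(⟨u, hub⟩, ⟨v, hvb⟩), hd⟩ (subset_closure (mem_image_of_mem f hpu)),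
      hg1 ⟨(⟨u, hub⟩, ⟨v, hvb⟩), hd⟩ (subset_closure (mem_image_of_mem f hqv))] at h
    simp at h
  have : Countable I := inferInstance
  exact (hcont.isClosedEmbedding hinj).isEmbedding.secondCountableTopology

theorem SouslinSpace.polishSpace (X : Type*) [TopologicalSpace X] [CompactSpace X]
    [SouslinSpace X] : PolishSpace X := by
  have := SouslinSpace.secondCountableTopology X
  let _ := TopologicalSpace.metrizableSpaceMetric X
  infer_instance

/-! ### Atomless measures -/

namespace SimultaneousOT

variable {X Y : Type*} [MeasurableSpace X] [MeasurableSpace Y]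

theorem Atomless.restrict {μ : Measure X} (hμ : Atomless μ) {C : Set X} (hC : MeasurableSet C) :
    Atomless (μ.restrict C) := by
  intro A hA hpos
  rw [Measure.restrict_apply hA] at hpos ⊢
  obtain ⟨B, hB, hBm, h0, h1⟩ := hμ _ (hA.inter hC) hpos
  have hBC : B ∩ C = B := inter_eq_left.2 (hB.trans inter_subset_right)
  refine ⟨B, hB.trans inter_subset_left, hBm, ?_⟩
  rw [Measure.restrict_apply hBm, hBC]
  exact ⟨h0, h1⟩

theorem Atomless.withDensity {μ : Measure X} [IsFiniteMeasure μ] (hμ : Atomless μ) {h : X → ℝ≥0∞}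
    (hh : Measurable h) (hle : ∀ x, h x ≤ 1) : Atomless (μ.withDensity h) := by
  intro A hA hpos
  have hS : MeasurableSet {x | h x ≠ 0} := hh (measurableSet_singleton 0).compl
  have hpos' (B : Set X) (hB : MeasurableSet B) :
      0 < μ.withDensity h B ↔ 0 < μ ({x | h x ≠ 0} ∩ B) := by
    rw [pos_iff_ne_zero, pos_iff_ne_zero, Ne, withDensity_apply_eq_zero hh]
  have hfin (B : Set X) (hB : MeasurableSet B) : μ.withDensity h B ≠ ∞ := by
    rw [withDensity_apply _ hB]
    refine ((lintegral_mono hle).trans_lt ?_).ne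
    simp
  obtain ⟨B, hB, hBm, h0, h1⟩ := hμ _ (hS.inter hA) ((hpos' A hA).1 hpos)
  have hBA : B ⊆ A := hB.trans inter_subset_right
  refine ⟨B, hBA, hBm, ?_, ?_⟩
  · rwa [hpos' B hBm, inter_eq_right.2 (hB.trans inter_subset_left)]
  · have hd : 0 < μ.withDensity h (A \ B) := by
      rw [hpos' _ (hA.diff hBm), ← inter_sdiff_assoc]
      exact (tsub_pos_of_lt h1).trans_le le_measure_sdiff
    rw [← measure_inter_add_sdiff A hBm, inter_eq_right.2 hBA]
    exact ENNReal.lt_add_right (hfin B hBm) hd.ne'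

/-- A set charged by an atomless measure contains arbitrarily many disjoint charged sets. -/
theorem Atomless.exists_disjoint_pos {μ : Measure X} [IsFiniteMeasure μ] (hμ : Atomless μ) (m : ℕ)
    {E : Set X} (hE : MeasurableSet E) (hpos : 0 < μ E) :
    ∃ F : Fin m → Set X, (∀ j, MeasurableSet (F j)) ∧ (∀ j, F j ⊆ E) ∧ (∀ j, 0 < μ (F j)) ∧
      Pairwise (Function.onFun Disjoint F) := by
  induction m generalizing E with
  | zero => exact ⟨fun _ => ∅, fun j => j.elim0, fun j => j.elim0, fun j => j.elim0,
      fun j => j.elim0⟩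
  | succ m ih =>
    obtain ⟨B, hBE, hB, h0, h1⟩ := hμ E hE hpos
    have hd : 0 < μ (E \ B) := (tsub_pos_of_lt h1).trans_le le_measure_sdiff
    obtain ⟨F, hFm, hFE, hFpos, hFd⟩ := ih (hE.diff hB) hd
    refine ⟨Fin.cons B F, ?_, ?_, ?_, ?_⟩
    · exact Fin.cases hB hFm
    · exact Fin.cases hBE fun j => (hFE j).trans sdiff_subset
    · exact Fin.cases h0 hFpos
    · have hBF (j : Fin m) : Disjoint B (F j) :=
        disjoint_sdiff_right.mono_right (hFE j)
      intro i j hij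
      induction i using Fin.cases with
      | zero =>
        induction j using Fin.cases with
        | zero => exact absurd rfl hij
        | succ j => simpa [Function.onFun] using hBF j
      | succ i =>
        induction j using Fin.cases with
        | zero => simpa [Function.onFun] using (hBF i).symm
        | succ j => simpa [Function.onFun] using hFd (fun h => hij (by rw [h]))

end SimultaneousOT

/-! ### Lyapunov's theorem -/

/-- In a real Hilbert space, a bounded nonempty set cut out by closed conditions on inner products
has an extreme point, because it is weakly compact. -/
theorem extremePoints_nonempty_of_forall_inner_mem {H J : Type*} [NormedAddCommGroup H]
    [InnerProductSpace ℝ H] [CompleteSpace H] {a : J → H} {C : J → Set ℝ}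
    (hC : ∀ j, IsClosed (C j)) {R : ℝ} (hR : ∀ g, (∀ j, inner ℝ (a j) g ∈ C j) → ‖g‖ ≤ R)
    (hne : {g | ∀ j, inner ℝ (a j) g ∈ C j}.Nonempty) :
    ({g | ∀ j, inner ℝ (a j) g ∈ C j}.extremePoints ℝ).Nonempty := by
  let e := InnerProductSpace.toDual ℝ H
  let K : Set (WeakDual ℝ H) := {Λ | ∀ j, Λ (a j) ∈ C j}
  have hKe (g : H) (h : ∀ j, inner ℝ (a j) g ∈ C j) : StrongDual.toWeakDual (e g) ∈ K := by
    intro j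
    have := h j
    rw [real_inner_comm] at this
    exact this
  have heK (Λ : WeakDual ℝ H) (h : Λ ∈ K) (j : J) :
      inner ℝ (a j) (e.symm (WeakDual.toStrongDual Λ)) ∈ C j := by
    rw [real_inner_comm, InnerProductSpace.toDual_symm_apply]
    exact h j
  have hcl : IsClosed K := by
    simp only [K, ofPred_forall]
    exact isClosed_iInter fun j => (hC j).preimage (WeakDual.eval_continuous (a j))
  have hK : IsCompact K := by
    refine (WeakDual.isCompact_closedBall (𝕜 := ℝ) (0 : StrongDual ℝ H) R).of_isClosed_subset hcl ?_
    intro Λ hΛ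
    have := hR _ (heK Λ hΛ)
    rw [LinearIsometryEquiv.norm_map] at this
    simpa using this
  obtain ⟨g₀, hg₀⟩ := hne
  have : LocallyConvexSpace ℝ (WeakDual ℝ H) :=
    inferInstanceAs (LocallyConvexSpace ℝ (WeakBilin (topDualPairing ℝ H)))
  obtain ⟨Λ, hΛ⟩ := hK.extremePoints_nonempty ⟨_, hKe g₀ hg₀⟩
  refine ⟨e.symm (WeakDual.toStrongDual Λ), ?_⟩
  rw [mem_extremePoints_iff_left] at hΛ ⊢
  refine ⟨heK Λ hΛ.1, fun g₁ hg₁ g₂ hg₂ hg => ?_⟩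
  have h := hΛ.2 _ (hKe g₁ hg₁) _ (hKe g₂ hg₂) ?_
  · rw [← h]
    simp
  · obtain ⟨s, t, hs, ht, hst, h⟩ := hg
    refine ⟨s, t, hs, ht, hst, ?_⟩
    have h' := congrArg (fun g => StrongDual.toWeakDual (e g)) h
    simpa using h'

/-- Among the functions with values in `[0, 1]` and prescribed integrals against finitely many
measures `μ i ≤ M`, some function is an extreme point; it is represented in `L²(M)`. -/
theorem exists_mem_extremePoints_Lp {X ι : Type*} [MeasurableSpace X] (M : Measure X)
    [IsFiniteMeasure M] (μ : ι → Measure X) (hμ : ∀ i, μ i ≤ M) (f₀ : Lp ℝ 2 M) (h0 : 0 ≤ᵐ[M] f₀) (h1 : f₀ ≤ᵐ[M] 1) :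
    ∃ g : Lp ℝ 2 M, g ∈ {g : Lp ℝ 2 M | 0 ≤ᵐ[M] g ∧ g ≤ᵐ[M] 1 ∧
      ∀ i, ∫ x, g x ∂(μ i) = ∫ x, f₀ x ∂(μ i)}.extremePoints ℝ := by
  have hfin (i : ι) : IsFiniteMeasure (μ i) := isFiniteMeasure_of_le M (hμ i)
  have hint (g : Lp ℝ 2 M) : Integrable g M := (Lp.memLp g).integrable (by norm_num)
  let ρ (i : ι) (x : X) : ℝ := ((μ i).rnDeriv M x).toReal
  have hρ (i : ι) : MemLp (ρ i) 2 M := by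
    refine MemLp.of_bound (by fun_prop) 1 ?_
    filter_upwards [Measure.rnDeriv_le_one_of_le (hμ i)] with x hx
    simpa [ρ] using ENNReal.toReal_mono (by simp) hx
  have hinner (i : ι) (g : Lp ℝ 2 M) : inner ℝ ((hρ i).toLp) g = ∫ x, g x ∂(μ i) := by
    rw [L2.inner_def, ← integral_rnDeriv_smul (Measure.absolutelyContinuous_of_le (hμ i))]
    refine integral_congr_ae ?_
    filter_upwards [(hρ i).coeFn_toLp] with x hx
    rw [hx]
    simp [ρ, mul_comm]
  let a : {s : Set X // MeasurableSet s} ⊕ ι → Lp ℝ 2 M :=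
    Sum.elim (fun s => indicatorConstLp 2 s.2 (measure_ne_top M _) 1) fun i => (hρ i).toLp
  let C : {s : Set X // MeasurableSet s} ⊕ ι → Set ℝ :=
    Sum.elim (fun s => Icc 0 (M.real s)) fun i => {∫ x, f₀ x ∂(μ i)}
  have hiff (g : Lp ℝ 2 M) : (0 ≤ᵐ[M] g ∧ g ≤ᵐ[M] 1 ∧
      ∀ i, ∫ x, g x ∂(μ i) = ∫ x, f₀ x ∂(μ i)) ↔ ∀ j, inner ℝ (a j) g ∈ C j := by
    simp only [Sum.forall, a, C, Sum.elim_inl, Sum.elim_inr, hinner, mem_singleton_iff, mem_Icc,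
      L2.inner_indicatorConstLp_one, Subtype.forall]
    rw [← and_assoc]
    refine and_congr_left fun _ => ⟨fun h s hs => ⟨?_, ?_⟩, fun h => ⟨?_, ?_⟩⟩
    · exact setIntegral_nonneg_of_ae h.1
    · have := setIntegral_mono_ae (s := s) (hint g).integrableOn (integrable_const 1).integrableOn
        h.2
      simpa using this
    · exact ae_nonneg_of_forall_setIntegral_nonneg (hint g) fun s hs _ => (h s hs).1
    · have : 0 ≤ᵐ[M] fun x => 1 - g x := by
        refine ae_nonneg_of_forall_setIntegral_nonneg ((integrable_const 1).sub (hint g))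
          fun s hs _ => ?_
        rw [integral_sub (integrable_const 1).integrableOn (hint g).integrableOn]
        simpa using (h s hs).2
      filter_upwards [this] with x hx
      simpa using hx
  simp only [hiff]
  refine extremePoints_nonempty_of_forall_inner_mem (R := ‖Lp.const 2 M (1 : ℝ)‖) ?_ ?_
    ⟨f₀, (hiff f₀).1 ⟨h0, h1, fun _ => rfl⟩⟩
  · rintro (s | i)
    · exact isClosed_Icc
    · exact isClosed_singleton
  · intro g hg
    obtain ⟨hg0, hg1, -⟩ := (hiff g).2 hg
    refine Lp.norm_le_norm_of_ae_le ?_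
    filter_upwards [hg0, hg1, Lp.coeFn_const (p := 2) (μ := M) (1 : ℝ)] with x hx0 hx1 hx
    rw [hx]
    simp only [Pi.zero_apply, Pi.one_apply] at hx0 hx1
    simpa [abs_of_nonneg hx0] using hx1

namespace SimultaneousOT

variable {X Y : Type*} [MeasurableSpace X] [MeasurableSpace Y]

/-- A set charged by a sum of finitely many atomless measures carries a nonzero bounded function
that is orthogonal to each of them. -/
theorem exists_integral_eq_zero_of_atomless {ι : Type*} [Fintype ι] (μ : ι → Measure X)
    [∀ i, IsFiniteMeasure (μ i)] (hμ : ∀ i, Atomless (μ i)) {E : Set X} (hE : MeasurableSet E)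
    (hpos : (∑ i, μ i) E ≠ 0) :
    ∃ h : X → ℝ, Measurable h ∧ (∀ x, |h x| ≤ 1) ∧ (∀ x ∉ E, h x = 0) ∧
      (∀ i, ∫ x, h x ∂(μ i) = 0) ∧ ¬ h =ᵐ[∑ i, μ i] 0 := by
  classical
  obtain ⟨i₀, hi₀⟩ : ∃ i, μ i E ≠ 0 := by
    by_contra! hall
    simp [hall] at hpos
  obtain ⟨F, hF, hFE, hFpos, hFd⟩ :=
    (hμ i₀).exists_disjoint_pos (Fintype.card ι + 1) hE (pos_iff_ne_zero.2 hi₀)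
  -- There is one set more than there are measures, so the integral conditions have a solution.
  let V : (Fin (Fintype.card ι + 1) → ℝ) →ₗ[ℝ] (ι → ℝ) :=
    LinearMap.pi fun i => ∑ j, (μ i).real (F j) • LinearMap.proj j
  have hV : V.ker ≠ ⊥ := LinearMap.ker_ne_bot_of_finrank_lt (by simp)
  obtain ⟨b, hbV, hb⟩ := Submodule.exists_mem_ne_zero_of_ne_bot hV
  have hbn : 0 < ‖b‖ := norm_pos_iff.2 hb
  let h (x : X) : ℝ := ∑ j, (F j).indicator (fun _ => b j / ‖b‖) x
  have hon (j) (x : X) (hx : x ∈ F j) : h x = b j / ‖b‖ := by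
    have : ∀ k, k ≠ j → (F k).indicator (fun _ => b k / ‖b‖) x = 0 := fun k hk =>
      indicator_of_notMem (fun hxk => disjoint_left.1 (hFd hk) hxk hx) _
    simp only [h]
    rw [Finset.sum_eq_single j (fun k _ hk => this k hk) (by simp), indicator_of_mem hx]
  have hoff (x : X) (hx : ∀ j, x ∉ F j) : h x = 0 :=
    Finset.sum_eq_zero fun j _ => indicator_of_notMem (hx j) _
  have hbj (j) : |b j / ‖b‖| ≤ 1 := by
    rw [abs_div, abs_norm]
    exact div_le_one_of_le₀ (norm_le_pi_norm b j) hbn.le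
  refine ⟨h, ?_, fun x => ?_, fun x hx => hoff x fun j hj => hx (hFE j hj), fun i => ?_, ?_⟩
  · exact Finset.measurable_sum _ fun j _ => measurable_const.indicator (hF j)
  · by_cases hx : ∃ j, x ∈ F j
    · obtain ⟨j, hj⟩ := hx
      rw [hon j x hj]
      exact hbj j
    · rw [hoff x (not_exists.1 hx)]
      simp
  · have hbi := congrFun (LinearMap.mem_ker.1 hbV) i
    simp only [V, LinearMap.pi_apply, LinearMap.sum_apply, LinearMap.smul_apply,
      LinearMap.proj_apply, smul_eq_mul, Pi.zero_apply] at hbi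
    simp only [h]
    rw [integral_finsetSum _ fun j _ => (integrable_const _).indicator (hF j)]
    simp only [integral_indicator_const _ (hF _), smul_eq_mul]
    simp only [← mul_div_assoc, ← Finset.sum_div, hbi, zero_div]
  · intro h0
    obtain ⟨j, hj⟩ := Function.ne_iff.1 hb
    have : F j ⊆ {x | ¬ h x = (0 : X → ℝ) x} := fun x hx => by
      simpa [hon j x hx, hbn.ne'] using hj
    have h1 : (∑ i, μ i) (F j) = 0 := measure_mono_null this h0
    rw [Measure.finsetSum_apply, Finset.sum_eq_zero_iff] at h1
    exact (hFpos j).ne' (h1 i₀ (Finset.mem_univ _))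

/-- **Lyapunov's theorem** for finitely many atomless measures: every function with values in
`[0, 1]` can be replaced by the indicator of a set without changing its integrals. -/
theorem exists_measurableSet_measure_eq_lintegral {ι : Type*} [Finite ι] (μ : ι → Measure X)
    [∀ i, IsFiniteMeasure (μ i)] (hμ : ∀ i, Atomless (μ i)) {f : X → ℝ≥0∞} (hf : Measurable f)
    (hle : ∀ x, f x ≤ 1) :
    ∃ A, MeasurableSet A ∧ ∀ i, μ i A = ∫⁻ x, f x ∂(μ i) := by
  classical
  have := Fintype.ofFinite ι
  let M := ∑ i, μ i
  have hM (i : ι) : μ i ≤ M := Finset.single_le_sum (fun _ _ => Measure.zero_le _)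
    (Finset.mem_univ i)
  have hfr (x : X) : (f x).toReal ≤ 1 := by simpa using ENNReal.toReal_mono (by simp) (hle x)
  have hfL : MemLp (fun x => (f x).toReal) 2 M :=
    MemLp.of_bound hf.ennreal_toReal.aestronglyMeasurable 1 (ae_of_all _ fun x => by simpa using hfr x)
  obtain ⟨g, hg⟩ := exists_mem_extremePoints_Lp M μ hM hfL.toLp
    (by filter_upwards [hfL.coeFn_toLp] with x hx; simp [hx])
    (by filter_upwards [hfL.coeFn_toLp] with x hx; simpa [hx] using hfr x)
  rw [mem_extremePoints] at hg
  obtain ⟨⟨hg0, hg1, hgi⟩, hext⟩ := hg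
  have hgm : Measurable g := (Lp.stronglyMeasurable g).measurable
  have hint (u : Lp ℝ 2 M) (i : ι) : Integrable u (μ i) :=
    ((Lp.memLp u).integrable (by norm_num)).mono_measure (hM i)
  -- A charged region where `g` stays away from `0` and `1` would allow to perturb `g` both ways.
  have hnull (ε : ℝ) (hε : 0 < ε) : M {x | ε ≤ g x ∧ g x ≤ 1 - ε} = 0 := by
    by_contra hne
    have hEm : MeasurableSet {x | ε ≤ g x ∧ g x ≤ 1 - ε} :=
      (measurableSet_le measurable_const hgm).inter (measurableSet_le hgm measurable_const)
    obtain ⟨h, hm, hb, hE, hi, h0⟩ := exists_integral_eq_zero_of_atomless μ hμ hEm hne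
    have hL : MemLp (fun x => ε * h x) 2 M := by
      refine MemLp.of_bound (by fun_prop) ε (ae_of_all _ fun x => ?_)
      rw [norm_mul, Real.norm_of_nonneg hε.le]
      exact mul_le_of_le_one_right hε.le (hb x)
    obtain ⟨u, hu⟩ : ∃ u : Lp ℝ 2 M, u =ᵐ[M] fun x => ε * h x := ⟨hL.toLp _, hL.coeFn_toLp⟩
    have hL0 (i : ι) : ∫ x, u x ∂(μ i) = 0 := by
      rw [integral_congr_ae ((Measure.absolutelyContinuous_of_le (hM i)).ae_le hu),
        integral_const_mul, hi i, mul_zero]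
    have key (x : X) (hx0 : 0 ≤ g x) (hx1 : g x ≤ 1) :
        (0 ≤ g x + ε * h x ∧ g x + ε * h x ≤ 1) ∧ 0 ≤ g x - ε * h x ∧ g x - ε * h x ≤ 1 := by
      by_cases hx : ε ≤ g x ∧ g x ≤ 1 - ε
      · obtain ⟨h1, h2⟩ := abs_le.1 (hb x)
        have h3 : ε * h x ≤ ε := mul_le_of_le_one_right hε.le h2
        have h4 : -ε ≤ ε * h x := by nlinarith
        refine ⟨⟨?_, ?_⟩, ?_, ?_⟩ <;> linarith [hx.1, hx.2]
      · simp [hE x hx, hx0, hx1]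
    have hplus := hext (g + u) ⟨?_, ?_, fun i => ?_⟩ (g - u) ⟨?_, ?_, fun i => ?_⟩ ?_
    · have hz : u = 0 := by simpa using hplus.1
      refine h0 ?_
      have h2 : u =ᵐ[M] 0 := by rw [hz]; exact Lp.coeFn_zero _ _ _
      filter_upwards [h2, hu] with x hx1 hx2
      rw [hx2] at hx1
      simpa [hε.ne'] using hx1
    · filter_upwards [hg0, hg1, hu, Lp.coeFn_add g u] with x hx0 hx1 hx2 hx3
      rw [hx3, Pi.add_apply, hx2]
      exact (key x hx0 hx1).1.1
    · filter_upwards [hg0, hg1, hu, Lp.coeFn_add g u] with x hx0 hx1 hx2 hx3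
      rw [hx3, Pi.add_apply, hx2]
      exact (key x hx0 hx1).1.2
    · rw [integral_congr_ae ((Measure.absolutelyContinuous_of_le (hM i)).ae_le
        (Lp.coeFn_add g u))]
      simp only [Pi.add_apply]
      rw [integral_add (hint g i) (hint _ i), hL0, add_zero, hgi]
    · filter_upwards [hg0, hg1, hu, Lp.coeFn_sub g u] with x hx0 hx1 hx2 hx3
      rw [hx3, Pi.sub_apply, hx2]
      exact (key x hx0 hx1).2.1
    · filter_upwards [hg0, hg1, hu, Lp.coeFn_sub g u] with x hx0 hx1 hx2 hx3
      rw [hx3, Pi.sub_apply, hx2]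
      exact (key x hx0 hx1).2.2
    · rw [integral_congr_ae ((Measure.absolutelyContinuous_of_le (hM i)).ae_le
        (Lp.coeFn_sub g u))]
      simp only [Pi.sub_apply]
      rw [integral_sub (hint g i) (hint _ i), hL0, sub_zero, hgi]
    · refine ⟨1 / 2, 1 / 2, by norm_num, by norm_num, by norm_num, ?_⟩
      rw [← smul_add, add_add_sub_cancel, ← two_smul ℝ g, smul_smul]
      norm_num
  have hA : MeasurableSet {x | g x = 1} := hgm (measurableSet_singleton 1)
  have hind : g =ᵐ[M] {x | g x = 1}.indicator fun _ => (1 : ℝ) := by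
    have hall : ∀ᵐ x ∂M, ∀ k : ℕ, ¬ (1 / ((k : ℝ) + 1) ≤ g x ∧ g x ≤ 1 - 1 / ((k : ℝ) + 1)) :=
      ae_all_iff.2 fun k => by
        rw [ae_iff]
        simpa only [not_not] using hnull _ (by positivity)
    filter_upwards [hg0, hg1, hall] with x hx0 hx1 hx
    by_cases hgx : g x = 1
    · rw [indicator_of_mem (show x ∈ {x | g x = 1} from hgx), hgx]
    · rw [indicator_of_notMem (show x ∉ {x | g x = 1} from hgx)]
      by_contra hgx0
      have h0 : 0 < g x := lt_of_le_of_ne hx0 (Ne.symm hgx0)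
      have h1 : 0 < 1 - g x := sub_pos.2 (lt_of_le_of_ne hx1 hgx)
      obtain ⟨k, hk⟩ := exists_nat_one_div_lt (lt_min h0 h1)
      refine hx k ⟨(hk.trans_le (min_le_left _ _)).le, ?_⟩
      linarith [hk.trans_le (min_le_right _ _)]
  refine ⟨_, hA, fun i => ?_⟩
  have hac := Measure.absolutelyContinuous_of_le (hM i)
  have h1 := hgi i
  rw [integral_congr_ae (hac.ae_le hind), integral_indicator_const _ hA,
    integral_congr_ae (hac.ae_le hfL.coeFn_toLp), integral_toReal hf.aemeasurable
      (ae_of_all _ fun x => (hle x).trans_lt ENNReal.one_lt_top), smul_eq_mul, mul_one] at h1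
  refine (ENNReal.toReal_eq_toReal_iff' (measure_ne_top _ _) ?_).1 h1
  exact ((lintegral_mono hle).trans_lt (by simp)).ne

end SimultaneousOT

/-! ### The Dvoretzky–Wald–Wolfowitz theorem -/

namespace SimultaneousOT

variable {X Y : Type*} [MeasurableSpace X] [MeasurableSpace Y]

/-- **Dvoretzky–Wald–Wolfowitz theorem**: a measurable family of probability vectors on a finite set
can be replaced by a measurable choice of a single label, without changing the integrals against
finitely many atomless measures. -/
theorem exists_measurable_label {ι : Type*} [Finite ι] (μ : ι → Measure X)
    [∀ i, IsFiniteMeasure (μ i)] (hμ : ∀ i, Atomless (μ i)) (m : ℕ) (f : Fin (m + 1) → X → ℝ≥0∞)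
    (hf : ∀ l, Measurable (f l)) (hsum : ∀ x, ∑ l, f l x = 1) :
    ∃ L : X → Fin (m + 1), Measurable L ∧ ∀ i l, μ i (L ⁻¹' {l}) = ∫⁻ x, f l x ∂(μ i) := by
  classical
  induction m generalizing ι with
  | zero =>
    refine ⟨fun _ => 0, measurable_const, fun i l => ?_⟩
    obtain rfl := Fin.fin_one_eq_zero l
    have h1 (x : X) : f 0 x = 1 := by simpa using hsum x
    simp [h1]
  | succ m ih =>
    let f' : Fin (m + 1) → X → ℝ≥0∞ :=
      Fin.cons (fun x => f 0 x + f 1 x) fun l => f l.succ.succ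
    have hf' (l) : Measurable (f' l) := by
      induction l using Fin.cases with
      | zero => exact (hf 0).add (hf 1)
      | succ l => exact hf _
    have hsum' (x : X) : ∑ l, f' l x = 1 := by
      rw [← hsum x, Fin.sum_univ_succ, Fin.sum_univ_succ (fun l => f l x), Fin.sum_univ_succ]
      simp [f', add_assoc]
    have hfin (l) (x : X) : f l x ≠ ∞ :=
      ((Finset.single_le_sum (f := fun l => f l x) (fun _ _ => zero_le) (Finset.mem_univ l)).trans_lt
        (by rw [hsum x]; exact ENNReal.one_lt_top)).ne
    -- The conditional probability of the label `0`, given that the label is `0` or `1`.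
    let h (x : X) : ℝ≥0∞ := f 0 x / (f 0 x + f 1 x)
    have hh : Measurable h := (hf 0).div ((hf 0).add (hf 1))
    have hle (x : X) : h x ≤ 1 := ENNReal.div_le_of_le_mul (by simp)
    have hmul (x : X) : h x * (f 0 x + f 1 x) = f 0 x :=
      ENNReal.div_mul_cancel' (fun h0 => by simp_all) fun ht => by simp_all
    have hden (i : ι) : IsFiniteMeasure ((μ i).withDensity h) :=
      isFiniteMeasure_withDensity (((lintegral_mono hle).trans_lt (by simp)).ne)
    -- The measures `h μᵢ` force `h` to have the right integral over the set of the merged label.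
    let μ' : ι ⊕ ι → Measure X := Sum.elim μ fun i => (μ i).withDensity h
    have hμfin (j) : IsFiniteMeasure (μ' j) := by
      rcases j with i | i
      exacts [inferInstanceAs (IsFiniteMeasure (μ i)), hden i]
    obtain ⟨L', hL', hL'μ⟩ := ih μ' (by
      rintro (i | i)
      exacts [hμ i, (hμ i).withDensity hh hle]) f' hf' hsum'
    have hS : MeasurableSet (L' ⁻¹' {0}) := hL' (measurableSet_singleton 0)
    obtain ⟨A, hA, hAμ⟩ := exists_measurableSet_measure_eq_lintegral
      (fun i => (μ i).restrict (L' ⁻¹' {0})) (fun i => (hμ i).restrict hS) hh hle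
    have hA0 (i : ι) : μ i (A ∩ L' ⁻¹' {0}) = ∫⁻ x, f 0 x ∂(μ i) := by
      have h1 := hAμ i
      have h2 := hL'μ (.inr i) 0
      rw [Measure.restrict_apply hA] at h1
      simp only [μ', Sum.elim_inr, f', Fin.cons_zero] at h2
      change _ = ∫⁻ x, (f 0 + f 1) x ∂_ at h2
      rw [withDensity_apply _ hS, lintegral_withDensity_eq_lintegral_mul _ hh
        ((hf 0).add (hf 1))] at h2
      rw [h1, h2]
      simp [hmul]
    have hA1 (i : ι) : μ i (L' ⁻¹' {0} \ A) = ∫⁻ x, f 1 x ∂(μ i) := by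
      have h1 := hL'μ (.inl i) 0
      simp only [μ', Sum.elim_inl, f', Fin.cons_zero] at h1
      rw [lintegral_add_left (hf 0), ← hA0 i, ← measure_inter_add_sdiff _ hA, inter_comm] at h1
      exact (ENNReal.add_right_inj (measure_ne_top _ _)).1 h1
    have hs1 (y : Fin (m + 1)) : y.succ = 1 ↔ y = 0 := by
      rw [← Fin.succ_zero_eq_one, Fin.succ_inj]
    have hs2 (l : Fin m) : (1 : Fin (m + 1 + 1)) ≠ l.succ.succ := fun h =>
      Fin.succ_ne_zero l ((hs1 _).1 h.symm)
    refine ⟨fun x => if L' x = 0 then (if x ∈ A then 0 else 1) else (L' x).succ, ?_, fun i l => ?_⟩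
    · exact Measurable.ite hS (Measurable.ite hA measurable_const measurable_const)
        ((measurable_of_countable Fin.succ).comp hL')
    · induction l using Fin.cases with
      | zero =>
        rw [← hA0 i]
        congr 1
        ext x
        by_cases h0 : L' x = 0 <;> by_cases hx : x ∈ A <;> simp [h0, hx]
      | succ l =>
        induction l using Fin.cases with
        | zero =>
          rw [Fin.succ_zero_eq_one, ← hA1 i]
          congr 1
          ext x
          by_cases h0 : L' x = 0 <;> by_cases hx : x ∈ A <;> simp [h0, hx, hs1]
        | succ l =>
          have h1 := hL'μ (.inl i) l.succ
          simp only [μ', Sum.elim_inl, f', Fin.cons_succ] at h1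
          rw [← h1]
          congr 1
          ext x
          by_cases h0 : L' x = 0 <;> by_cases hx : x ∈ A <;> 
            simp [h0, hx, hs2, (Fin.succ_ne_zero _).symm]

end SimultaneousOT

/-! ### Maps transporting several atomless measures to one measure -/

open Filter Topology unitInterval in
/-- The distribution function of an atomless law pushes it to the uniform law on `[0, 1]`. -/
theorem map_cdf_eq_restrict_volume (P : Measure ℝ) [IsProbabilityMeasure P] [NullSingletonClass P] :
    P.map (cdf P) = volume.restrict (Icc 0 1) := by
  have hcont : Continuous (cdf P) := continuous_iff_continuousAt.2 fun a => by
    rw [(monotone_cdf P).continuousAt_iff_leftLim_eq_rightLim, (cdf P).rightLim_eq]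
    have h := (cdf P).measure_singleton a
    rw [measure_cdf, measure_singleton, eq_comm, ENNReal.ofReal_eq_zero] at h
    exact le_antisymm ((monotone_cdf P).leftLim_le le_rfl) (by linarith)
  have hIVT (a : ℝ) (h0 : 0 < a) (h1 : a < 1) : ∃ q, cdf P q = a := by
    obtain ⟨x, hx⟩ := ((tendsto_cdf_atBot P).eventually_lt_const h0).exists
    obtain ⟨y, hy⟩ := ((tendsto_cdf_atTop P).eventually_const_lt h1).exists
    exact mem_range_of_exists_le_of_exists_ge hcont ⟨x, hx.le⟩ ⟨y, hy.le⟩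
  have hm : Measurable (cdf P) := hcont.measurable
  have hpre (q : ℝ) : P (Iic q) = ENNReal.ofReal (cdf P q) := (ofReal_cdf P q).symm
  have : IsProbabilityMeasure (P.map (cdf P)) := Measure.isProbabilityMeasure_map hm.aemeasurable
  refine Measure.ext_of_Iic _ _ fun a => ?_
  rw [Measure.map_apply hm measurableSet_Iic, Measure.restrict_apply measurableSet_Iic]
  rcases lt_or_ge a 0 with ha | ha
  · have h1 : (cdf P) ⁻¹' Iic a = ∅ :=
      eq_empty_of_forall_notMem fun x hx => (ha.trans_le (cdf_nonneg P x)).not_ge hx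
    have h2 : Iic a ∩ Icc 0 1 = ∅ :=
      eq_empty_of_forall_notMem fun x hx => (ha.trans_le hx.2.1).not_ge hx.1
    rw [h1, h2]
    simp
  rcases le_or_gt 1 a with ha1 | ha1
  · have h1 : (cdf P) ⁻¹' Iic a = univ :=
      eq_univ_of_forall fun x => (cdf_le_one P x).trans ha1
    have h2 : Iic a ∩ Icc 0 1 = Icc (0 : ℝ) 1 :=
      inter_eq_right.2 fun x hx => hx.2.trans ha1
    rw [h1, h2]
    simp
  have h2 : Iic a ∩ Icc 0 1 = Icc 0 a := by
    ext x
    simp only [mem_inter_iff, mem_Iic, mem_Icc]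
    constructor
    · rintro ⟨h, h', -⟩
      exact ⟨h', h⟩
    · rintro ⟨h, h'⟩
      exact ⟨h', h, h'.trans ha1.le⟩
  rw [h2, Real.volume_Icc, sub_zero]
  refine le_antisymm ?_ ?_
  · refine le_of_forall_gt_imp_ge_of_dense fun b hb => ?_
    obtain ⟨r, hr, hrb⟩ : ∃ r, a < r ∧ r < 1 ∧ ENNReal.ofReal r ≤ b := by
      have h1 : ENNReal.ofReal a < min b 1 := lt_min hb (ENNReal.ofReal_lt_one.2 ha1)
      obtain ⟨r, -, har, hr⟩ := ENNReal.lt_iff_exists_real_btwn.1 h1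
      obtain ⟨hrb, hr1⟩ := lt_min_iff.1 hr
      exact ⟨r, (ENNReal.ofReal_lt_ofReal_iff_of_nonneg ha).1 har, ENNReal.ofReal_lt_one.1 hr1,
        hrb.le⟩
    obtain ⟨q, hq⟩ := hIVT r (ha.trans_lt hr) hrb.1
    refine le_trans ?_ hrb.2
    rw [← hq, ← hpre]
    refine measure_mono fun x hx => ?_
    by_contra hxq
    have := monotone_cdf P (not_le.1 hxq).le
    have hx' : cdf P x ≤ a := hx
    linarith
  · rcases ha.eq_or_lt with rfl | ha
    · simp
    · obtain ⟨q, rfl⟩ := hIVT a ha ha1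
      rw [← hpre]
      exact measure_mono fun x hx => monotone_cdf P hx

/-- An atomless probability measure on a standard Borel space can be mapped to any probability
measure on a standard Borel space. -/
theorem exists_measurable_map_eq_of_nullSingletonClass {Z Y : Type*} [MeasurableSpace Z]
    [StandardBorelSpace Z] [MeasurableSpace Y] [StandardBorelSpace Y] (P : Measure Z)
    [IsProbabilityMeasure P] [NullSingletonClass P]
    (Q : Measure Y) [IsProbabilityMeasure Q] : ∃ g : Z → Y, Measurable g ∧ P.map g = Q := by
  have he := measurableEmbedding_embeddingReal Z
  have hP : IsProbabilityMeasure (P.map (embeddingReal Z)) :=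
    Measure.isProbabilityMeasure_map he.measurable.aemeasurable
  have hN : NullSingletonClass (P.map (embeddingReal Z)) := by
    refine ⟨fun x => ?_⟩
    rw [Measure.map_apply he.measurable (measurableSet_singleton x)]
    exact (subsingleton_singleton.preimage he.injective).measure_zero P
  have hm : Measurable (cdf (P.map (embeddingReal Z))) := (monotone_cdf _).measurable
  have : Nonempty Y := nonempty_of_isProbabilityMeasure Q
  obtain ⟨f, hf, hfQ⟩ := Q.exists_measurable_map_eq
  have hpr : Measurable (projIcc (0 : ℝ) 1 zero_le_one) := continuous_projIcc.measurable
  refine ⟨fun z => f (projIcc 0 1 zero_le_one (cdf (P.map (embeddingReal Z)) (embeddingReal Z z))),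
    hf.comp (hpr.comp (hm.comp he.measurable)), ?_⟩
  have h1 : P.map (fun z => f (projIcc 0 1 zero_le_one
      (cdf (P.map (embeddingReal Z)) (embeddingReal Z z)))) =
      (((P.map (embeddingReal Z)).map (cdf (P.map (embeddingReal Z)))).map
        (projIcc (0 : ℝ) 1 zero_le_one)).map f := by
    rw [Measure.map_map hf hpr, Measure.map_map (hf.comp hpr) hm,
      Measure.map_map ((hf.comp hpr).comp hm) he.measurable]
    rfl
  rw [h1, map_cdf_eq_restrict_volume, ← hfQ,
    ← (measurePreserving_subtype_coe measurableSet_Icc).map_eq,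
    Measure.map_map hpr measurable_subtype_coe]
  have h2 : projIcc (0 : ℝ) 1 zero_le_one ∘ Subtype.val = id := by
    ext x
    simp
  rw [h2, Measure.map_id, ← unitInterval.volume_def]

/-- Finite measures on the Cantor space are determined by their values on cylinders. -/
theorem MeasureTheory.Measure.ext_of_cylinder (P Q : Measure (ℕ → Bool)) [IsFiniteMeasure P]
    (h : ∀ y k, P (PiNat.cylinder y k) = Q (PiNat.cylinder y k)) : P = Q := by
  refine ext_of_generate_finite _ ((BorelSpace.measurable_eq (α := ℕ → Bool)).trans
    (PiNat.isTopologicalBasis_cylinders fun _ : ℕ => Bool).borel_eq_generateFrom) ?_ ?_ ?_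
  · rintro _ ⟨x, m, rfl⟩ _ ⟨y, n, rfl⟩ ⟨z, hzx, hzy⟩
    rw [PiNat.mem_cylinder_iff_eq] at hzx hzy
    rw [← hzx, ← hzy]
    rcases le_total m n with hmn | hmn
    · exact ⟨z, n, inter_eq_right.2 (PiNat.cylinder_anti z hmn)⟩
    · exact ⟨z, m, inter_eq_left.2 (PiNat.cylinder_anti z hmn)⟩
  · rintro _ ⟨x, m, rfl⟩
    exact h x m
  · simpa using h (fun _ => false) 0

namespace SimultaneousOT

variable {X Y : Type*} [MeasurableSpace X] [MeasurableSpace Y]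

/-- Finitely many atomless measures admit a common sequence of fair coin tosses: by Lyapunov's
theorem each cell of the current finite partition can be halved with respect to all of them. -/
theorem exists_measurable_cylinder {ι : Type*} [Finite ι] (μ : ι → Measure X)
    [∀ i, IsFiniteMeasure (μ i)] (hμ : ∀ i, Atomless (μ i)) :
    ∃ t : X → ℕ → Bool, Measurable t ∧
      ∀ i y k, μ i (t ⁻¹' PiNat.cylinder y k) = 2⁻¹ ^ k * μ i univ := by
  classical
  have step (k : ℕ) (s : X → Fin k → Bool) (hs : Measurable s) : ∃ b : X → Bool, Measurable b ∧
      ∀ i w β, μ i {x | s x = w ∧ b x = β} = 2⁻¹ * μ i {x | s x = w} := by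
    have hw (w) : MeasurableSet {x | s x = w} := hs (measurableSet_singleton w)
    obtain ⟨A, hA, hAμ⟩ := exists_measurableSet_measure_eq_lintegral
      (fun j : ι × (Fin k → Bool) => (μ j.1).restrict {x | s x = j.2})
      (fun j => (hμ j.1).restrict (hw j.2)) (f := fun _ => 2⁻¹) measurable_const (by simp)
    have h1 (i w) : μ i ({x | s x = w} ∩ A) = 2⁻¹ * μ i {x | s x = w} := by
      simpa [Measure.restrict_apply hA, inter_comm] using hAμ (i, w)
    have h2 (i w) : μ i ({x | s x = w} \ A) = 2⁻¹ * μ i {x | s x = w} := by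
      have h := measure_inter_add_sdiff (μ := μ i) {x | s x = w} hA
      rw [h1] at h
      nth_rw 2 [← one_mul (μ i {x | s x = w})] at h
      rw [← ENNReal.inv_two_add_inv_two, add_mul] at h
      exact (ENNReal.add_right_inj (ENNReal.mul_ne_top (by simp) (measure_ne_top _ _))).1 h
    refine ⟨fun x => decide (x ∈ A), ?_, fun i w β => ?_⟩
    · exact measurable_to_bool (by simpa [preimage] using hA)
    · cases β
      · rw [← h2]
        congr 1
        ext x
        simp
      · rw [← h1]
        congr 1
        ext x
        simp
  choose b hb hbμ using step
  -- `s k` records the first `k` tosses.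
  let s (k : ℕ) : {s : X → Fin k → Bool // Measurable s} :=
    Nat.rec ⟨fun _ => Fin.elim0, measurable_const⟩
      (fun k s => ⟨fun x => Fin.snoc (s.1 x) (b k s.1 s.2 x), by
        refine measurable_pi_lambda _ fun j => ?_
        induction j using Fin.lastCases with
        | last => simpa using hb k s.1 s.2
        | cast j => simpa [Function.comp_def] using (measurable_pi_apply j).comp s.2⟩) k
  have hss (k : ℕ) (x : X) : (s (k + 1)).1 x = Fin.snoc ((s k).1 x) (b k (s k).1 (s k).2 x) := rfl
  let t (x : X) (k : ℕ) : Bool := b k (s k).1 (s k).2 x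
  have hst (k : ℕ) (x : X) : (s k).1 x = fun j : Fin k => t x j := by
    induction k with
    | zero => exact Subsingleton.elim _ _
    | succ k ih =>
      rw [hss, ih]
      ext j
      induction j using Fin.lastCases with
      | last => simp [t]
      | cast j => simp
  refine ⟨t, measurable_pi_lambda _ fun k => hb k _ _, fun i y k => ?_⟩
  induction k with
  | zero => simp
  | succ k ih =>
    have h1 : t ⁻¹' PiNat.cylinder y k = {x | (s k).1 x = fun j : Fin k => y j} := by
      ext x
      simp only [mem_preimage, PiNat.mem_cylinder_iff, mem_ofPred_eq, hst, funext_iff]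
      exact ⟨fun h j => h j j.2, fun h j hj => h ⟨j, hj⟩⟩
    have h2 : t ⁻¹' PiNat.cylinder y (k + 1) =
        {x | ((s k).1 x = fun j : Fin k => y j) ∧ b k (s k).1 (s k).2 x = y k} := by
      ext x
      have h3 : x ∈ t ⁻¹' PiNat.cylinder y k ↔ (s k).1 x = fun j : Fin k => y j := by rw [h1]; rfl
      simp only [mem_preimage, PiNat.mem_cylinder_iff, mem_ofPred_eq] at h3 ⊢
      rw [← h3]
      exact ⟨fun h => ⟨fun j hj => h j (by omega), h k (by omega)⟩, fun h j hj =>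
        (Nat.lt_succ_iff_lt_or_eq.1 hj).elim (h.1 j) fun e => e ▸ h.2⟩
    rw [h2, hbμ, ← h1, ih, pow_succ', mul_assoc]

/-- Finitely many atomless measures of equal mass can be transported by a single map to any measure
of that mass on a standard Borel space. -/
theorem exists_measurable_map_eq_of_atomless {ι : Type*} [Finite ι] (μ : ι → Measure X)
    [∀ i, IsFiniteMeasure (μ i)] (hμ : ∀ i, Atomless (μ i)) [StandardBorelSpace Y] [Nonempty Y]
    (ν : Measure Y) [IsFiniteMeasure ν] (h : ∀ i, μ i univ = ν univ) :
    ∃ T : X → Y, Measurable T ∧ ∀ i, (μ i).map T = ν := by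
  rcases isEmpty_or_nonempty ι with hι | ⟨⟨i₀⟩⟩
  · exact ⟨fun _ => Classical.arbitrary Y, measurable_const, fun i => hι.elim i⟩
  rcases eq_or_ne ν 0 with rfl | hν
  · refine ⟨fun _ => Classical.arbitrary Y, measurable_const, fun i => ?_⟩
    have : μ i = 0 := by simpa using h i
    simp [this]
  obtain ⟨t, ht, htμ⟩ := exists_measurable_cylinder μ hμ
  have hcyl (y : ℕ → Bool) (k : ℕ) : MeasurableSet (PiNat.cylinder y k) :=
    (PiNat.isOpen_cylinder _ y k).measurableSet
  have hmap (i : ι) (y : ℕ → Bool) (k : ℕ) :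
      (μ i).map t (PiNat.cylinder y k) = 2⁻¹ ^ k * ν univ := by
    rw [Measure.map_apply ht (hcyl y k), htμ, h]
  have hlaw (i : ι) : (μ i).map t = (μ i₀).map t :=
    Measure.ext_of_cylinder _ _ fun y k => by rw [hmap, hmap]
  have hm0 : ν univ ≠ 0 := by simpa using hν
  have hmt : ν univ ≠ ∞ := measure_ne_top _ _
  have hprob (ρ : Measure (ℕ → Bool)) (hρ : ρ univ = ν univ) :
      IsProbabilityMeasure ((ν univ)⁻¹ • ρ) :=
    ⟨by simp [hρ, ENNReal.inv_mul_cancel hm0 hmt]⟩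
  have hP := hprob ((μ i₀).map t) (by rw [Measure.map_apply ht .univ, preimage_univ, h])
  have hQ : IsProbabilityMeasure ((ν univ)⁻¹ • ν) :=
    ⟨by simp [ENNReal.inv_mul_cancel hm0 hmt]⟩
  have hN : NullSingletonClass ((ν univ)⁻¹ • (μ i₀).map t) := by
    refine ⟨fun y => ?_⟩
    have h0 (k : ℕ) : (μ i₀).map t {y} ≤ 2⁻¹ ^ k * ν univ := by
      rw [← hmap i₀ y k]
      exact measure_mono (singleton_subset_iff.2 (PiNat.self_mem_cylinder y k))
    have hlim : Filter.Tendsto (fun k : ℕ => (2⁻¹ : ℝ≥0∞) ^ k * ν univ) Filter.atTop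
        (nhds (0 * ν univ)) :=
      ENNReal.Tendsto.mul_const (ENNReal.tendsto_pow_atTop_nhds_zero_of_lt_one (by simp))
        (Or.inr hmt)
    have : (μ i₀).map t {y} = 0 := by
      simpa using ge_of_tendsto' hlim h0
    simp [this]
  obtain ⟨g, hg, hgQ⟩ := exists_measurable_map_eq_of_nullSingletonClass ((ν univ)⁻¹ • (μ i₀).map t)
    ((ν univ)⁻¹ • ν)
  refine ⟨g ∘ t, hg.comp ht, fun i => ?_⟩
  rw [← Measure.map_map hg ht, hlaw]
  rw [Measure.map_smul] at hgQ
  have := congrArg (fun ρ => ν univ • ρ) hgQ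
  simpa [smul_smul, ENNReal.mul_inv_cancel hm0 hmt] using this

end SimultaneousOT

/-! ### Existence of an optimal simultaneous plan -/

open BoundedContinuousFunction Topology in
/-- Reweighting by an integrable density in the first variable is compatible with weak convergence
of measures with a fixed first marginal: the density is an `L¹`-limit of continuous functions. -/
theorem isClosed_setOf_map_snd_withDensity_eq {X Y : Type*}
    [TopologicalSpace X] [PolishSpace X] [MeasurableSpace X] [BorelSpace X]
    [TopologicalSpace Y] [PolishSpace Y] [MeasurableSpace Y] [BorelSpace Y]
    (M : Measure X) [IsProbabilityMeasure M] {ρ : X → ℝ≥0∞} (hρ : Measurable ρ)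
    (hρM : ∫⁻ x, ρ x ∂M ≠ ∞) (ν : Measure Y) [IsFiniteMeasure ν] :
    IsClosed {P : ProbabilityMeasure (X × Y) | (P : Measure (X × Y)).map Prod.fst = M ∧
      ((P : Measure (X × Y)).withDensity (ρ ∘ Prod.fst)).map Prod.snd = ν} := by
  let _ := TopologicalSpace.upgradeIsCompletelyMetrizable X
  let _ := TopologicalSpace.upgradeIsCompletelyMetrizable Y
  let s := {P : ProbabilityMeasure (X × Y) | (P : Measure (X × Y)).map Prod.fst = M}
  let J (φ : Y →ᵇ ℝ) (P : ProbabilityMeasure (X × Y)) : ℝ :=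
    ∫ p, (ρ p.1).toReal * φ p.2 ∂(P : Measure (X × Y))
  have hs : IsClosed s := by
    let M' : ProbabilityMeasure X := ⟨M, inferInstance⟩
    have h : IsClosed {P : ProbabilityMeasure (X × Y) |
        P.map continuous_fst.measurable.aemeasurable = M'} :=
      isClosed_eq (ProbabilityMeasure.continuous_map continuous_fst) continuous_const
    convert h using 1
    ext P
    exact ProbabilityMeasure.toMeasure_injective.eq_iff
      (a := P.map continuous_fst.measurable.aemeasurable) (b := M')
  have hρint : Integrable (fun x => (ρ x).toReal) M :=
    integrable_toReal_of_lintegral_ne_top hρ.aemeasurable hρM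
  have hfst {P : ProbabilityMeasure (X × Y)} (hP : P ∈ s) {u : X → ℝ} (hu : Integrable u M) :
      Integrable (fun p : X × Y => u p.1) (P : Measure (X × Y)) := by
    have hP' : (P : Measure (X × Y)).map Prod.fst = M := hP
    rw [← hP'] at hu
    exact hu.comp_measurable measurable_fst
  have hmul {P : ProbabilityMeasure (X × Y)} (hP : P ∈ s) {u : X → ℝ} (hu : Integrable u M)
      (φ : Y →ᵇ ℝ) : Integrable (fun p : X × Y => u p.1 * φ p.2) (P : Measure (X × Y)) :=
    (hfst hP hu).mul_bdd (c := ‖φ‖) (φ.continuous.measurable.comp measurable_snd).aestronglyMeasurable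
      (ae_of_all _ fun p => φ.norm_coe_le_norm p.2)
  have hJ (φ : Y →ᵇ ℝ) : ContinuousOn (J φ) s := by
    refine continuousOn_of_uniform_approx_of_continuousOn fun u hu => ?_
    obtain ⟨ε, hε, hεu⟩ := Metric.mem_uniformity_dist.1 hu
    obtain ⟨g, hg, hgi⟩ := hρint.exists_boundedContinuous_integral_sub_le
      (ε := ε / (2 * (‖φ‖ + 1))) (by positivity)
    refine ⟨fun P => ∫ p, g p.1 * φ p.2 ∂(P : Measure (X × Y)), ?_, fun P hP => hεu ?_⟩
    · exact (ProbabilityMeasure.continuous_integral_boundedContinuousFunction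
        ((g.compContinuous ⟨Prod.fst, continuous_fst⟩) *
          (φ.compContinuous ⟨Prod.snd, continuous_snd⟩))).continuousOn
    · have hd := hρint.sub hgi
      have h1 : ∫ p : X × Y, ‖(ρ p.1).toReal - g p.1‖ ∂(P : Measure (X × Y)) =
          ∫ x, ‖(ρ x).toReal - g x‖ ∂M := by
        have hP' : (P : Measure (X × Y)).map Prod.fst = M := hP
        rw [← hP', integral_map measurable_fst.aemeasurable]
        rw [hP']
        exact hd.norm.aestronglyMeasurable
      rw [Real.dist_eq, ← integral_sub (hmul hP hρint φ) (hmul hP hgi φ), ← Real.norm_eq_abs]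
      calc ‖∫ p, (ρ p.1).toReal * φ p.2 - g p.1 * φ p.2 ∂(P : Measure (X × Y))‖
          ≤ ∫ p : X × Y, ‖(ρ p.1).toReal - g p.1‖ * ‖φ‖ ∂(P : Measure (X × Y)) := by
            refine norm_integral_le_of_norm_le ((hfst hP hd.norm).mul_const _)
              (ae_of_all _ fun p => ?_)
            rw [← sub_mul, norm_mul]
            exact mul_le_mul_of_nonneg_left (φ.norm_coe_le_norm p.2) (norm_nonneg _)
        _ ≤ ε / (2 * (‖φ‖ + 1)) * ‖φ‖ := by
            rw [integral_mul_const, h1]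
            exact mul_le_mul_of_nonneg_right hg (norm_nonneg _)
        _ < ε := by
            rw [div_mul_eq_mul_div, div_lt_iff₀ (by positivity)]
            nlinarith [norm_nonneg φ]
  have hset : {P : ProbabilityMeasure (X × Y) | (P : Measure (X × Y)).map Prod.fst = M ∧
      ((P : Measure (X × Y)).withDensity (ρ ∘ Prod.fst)).map Prod.snd = ν} =
      s ∩ ⋂ φ : Y →ᵇ ℝ, (s ∩ J φ ⁻¹' {∫ y, φ y ∂ν}) := by
    ext P
    simp only [mem_ofPred_eq, mem_inter_iff, mem_iInter, mem_preimage, mem_singleton_iff]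
    refine and_congr_right fun hP => ?_
    have hPs : P ∈ s := hP
    have hlt : ∀ᵐ p ∂(P : Measure (X × Y)), (ρ ∘ Prod.fst) p < ∞ := by
      have h := ae_lt_top hρ hρM
      rw [← hP] at h
      exact ae_of_ae_map measurable_fst.aemeasurable h
    have hfin : IsFiniteMeasure ((P : Measure (X × Y)).withDensity (ρ ∘ Prod.fst)) := by
      refine isFiniteMeasure_withDensity ?_
      rw [← hP, lintegral_map hρ measurable_fst] at hρM
      exact hρM
    have hJφ (φ : Y →ᵇ ℝ) : J φ P =
        ∫ y, φ y ∂((P : Measure (X × Y)).withDensity (ρ ∘ Prod.fst)).map Prod.snd := by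
      rw [integral_map measurable_snd.aemeasurable φ.continuous.measurable.aestronglyMeasurable,
        integral_withDensity_eq_integral_toReal_smul (hρ.comp measurable_fst) hlt]
      rfl
    constructor
    · intro h φ
      exact ⟨hPs, by rw [hJφ, h]⟩
    · intro h
      exact ext_of_forall_integral_eq_of_IsFiniteMeasure fun φ => by rw [← hJφ, (h φ).2]
  rw [hset]
  exact hs.inter (isClosed_iInter fun φ =>
    (hJ φ).preimage_isClosed_of_isClosed hs isClosed_singleton)

namespace SimultaneousOT

variable {X Y : Type*} [MeasurableSpace X] [MeasurableSpace Y]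

theorem isProbabilityMeasure_avg {n : ℕ} (hn : 1 ≤ n) (μ : Fin n → Measure X)
    [∀ i, IsProbabilityMeasure (μ i)] : IsProbabilityMeasure (avg μ) := by
  refine ⟨?_⟩
  have : (n : ℝ≥0∞) ≠ 0 := by exact_mod_cast (by omega : n ≠ 0)
  simp [avg, ENNReal.inv_mul_cancel this (ENNReal.natCast_ne_top n)]

theorem absolutelyContinuous_avg {n : ℕ} (μ : Fin n → Measure X) (i : Fin n) : μ i ≪ avg μ := by
  intro s hs
  simp only [avg, Measure.smul_apply, Measure.finsetSum_apply, smul_eq_mul, mul_eq_zero,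
    ENNReal.inv_eq_zero, ENNReal.natCast_ne_top, false_or, Finset.sum_eq_zero_iff] at hs
  exact hs i (Finset.mem_univ i)

theorem IsConditional.eq_compProd {π : Measure (X × Y)} {M : Measure X} [IsFiniteMeasure M]
    {κ : Kernel X Y} (h : IsConditional π M κ) : π = M ⊗ₘ κ := by
  have := h.1
  symm
  refine Measure.ext_prod fun hs ht => ?_
  rw [h.2 _ _ hs ht, Measure.compProd_apply_prod hs ht]

/-- Reweighting the first variable before taking the second marginal amounts to integrating the
kernel against the reweighted measure. -/
theorem map_snd_withDensity_compProd (M : Measure X) [IsFiniteMeasure M] (κ : Kernel X Y)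
    [IsMarkovKernel κ] {ρ : X → ℝ≥0∞} (hρ : Measurable ρ) {B : Set Y} (hB : MeasurableSet B) :
    ((M ⊗ₘ κ).withDensity (ρ ∘ Prod.fst)).map Prod.snd B = ∫⁻ x, κ x B ∂(M.withDensity ρ) := by
  have hBm : MeasurableSet (Prod.snd ⁻¹' B : Set (X × Y)) := measurable_snd hB
  rw [Measure.map_apply measurable_snd hB, withDensity_apply _ hBm, ← lintegral_indicator hBm,
    Measure.lintegral_compProd ((hρ.comp measurable_fst).indicator hBm),
    lintegral_withDensity_eq_lintegral_mul _ hρ (κ.measurable_coe hB)]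
  refine lintegral_congr fun x => ?_
  have : (fun b => (Prod.snd ⁻¹' B : Set (X × Y)).indicator (ρ ∘ Prod.fst) (x, b)) =
      B.indicator fun _ => ρ x := by
    ext b
    by_cases hb : b ∈ B <;> simp [hb]
  rw [this, lintegral_indicator_const hB]
  rfl

/-- Simultaneous transport plans in terms of the densities of the `μ i` with respect to their
average, without reference to conditional probabilities. -/
theorem mem_plans_iff [StandardBorelSpace Y] [Nonempty Y] {n : ℕ} (hn : 1 ≤ n)
    (μ : Fin n → Measure X) [∀ i, IsProbabilityMeasure (μ i)] (ν : Measure Y) (π : Measure (X × Y)) :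
    π ∈ plans μ ν ↔ π.map Prod.fst = avg μ ∧ ∀ i,
      (π.withDensity ((μ i).rnDeriv (avg μ) ∘ Prod.fst)).map Prod.snd = ν := by
  have := isProbabilityMeasure_avg hn μ
  have hden (i : Fin n) : (avg μ).withDensity ((μ i).rnDeriv (avg μ)) = μ i :=
    Measure.withDensity_rnDeriv_eq _ _ (absolutelyContinuous_avg μ i)
  constructor
  · rintro ⟨⟨h1, -⟩, κ, hκ, h⟩
    have := hκ.1
    refine ⟨?_, fun i => ?_⟩
    · ext A hA
      rw [Measure.map_apply measurable_fst hA, ← h1 A hA, prod_univ]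
    · ext B hB
      rw [hκ.eq_compProd, map_snd_withDensity_compProd _ _ (Measure.measurable_rnDeriv _ _) hB,
        hden, h i B hB]
  · rintro ⟨h1, h⟩
    have hfin : IsFiniteMeasure π := by
      refine ⟨?_⟩
      have := congrArg (fun ρ => ρ univ) h1
      rw [Measure.map_apply measurable_fst .univ, preimage_univ] at this
      rw [this]
      exact measure_lt_top _ _
    have hπ : avg μ ⊗ₘ π.condKernel = π := by
      rw [← h1]
      exact π.disintegrate π.condKernel
    have hκ (i : Fin n) (B : Set Y) (hB : MeasurableSet B) :
        ∫⁻ x, π.condKernel x B ∂(μ i) = ν B := by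
      rw [← hden i, ← map_snd_withDensity_compProd _ _ (Measure.measurable_rnDeriv _ _) hB, hπ, h]
    refine ⟨⟨fun A hA => ?_, fun B hB => ?_⟩, π.condKernel, ⟨inferInstance, fun A B hA hB => ?_⟩, hκ⟩
    · rw [← h1, Measure.map_apply measurable_fst hA, prod_univ]
    · rw [← hπ, Measure.compProd_apply_prod .univ hB, Measure.restrict_univ, avg,
        lintegral_smul_measure, lintegral_finsetSum_measure]
      simp only [hκ _ B hB, Finset.sum_const, Finset.card_univ, Fintype.card_fin, nsmul_eq_mul,
        smul_eq_mul]
      rw [← mul_assoc, ENNReal.inv_mul_cancel _ (ENNReal.natCast_ne_top n), one_mul]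
      exact_mod_cast (by omega : n ≠ 0)
    · conv_lhs => rw [← hπ]
      exact Measure.compProd_apply_prod hA hB

theorem prod_mem_plans {n : ℕ} (hn : 1 ≤ n) (μ : Fin n → Measure X)
    [∀ i, IsProbabilityMeasure (μ i)] (ν : Measure Y) [IsProbabilityMeasure ν] :
    (avg μ).prod ν ∈ plans μ ν := by
  have := isProbabilityMeasure_avg hn μ
  refine ⟨⟨fun A _ => by simp, fun B _ => by simp⟩, Kernel.const X ν,
    ⟨inferInstance, fun A B _ _ => ?_⟩, fun i B _ => by simp⟩
  simp [mul_comm]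

/-- The cost attains its minimum over the simultaneous transport plans, which form a weakly compact
set. -/
theorem exists_isLeast_kantorovichCost
    [TopologicalSpace X] [CompactSpace X] [PolishSpace X] [BorelSpace X]
    [TopologicalSpace Y] [CompactSpace Y] [PolishSpace Y] [BorelSpace Y]
    {c : X × Y → ℝ≥0} (hc : Continuous c) {n : ℕ} (hn : 1 ≤ n) (μ : Fin n → Measure X)
    [∀ i, IsProbabilityMeasure (μ i)] (ν : Measure Y) [IsProbabilityMeasure ν] :
    ∃ v : ℝ≥0, IsLeast (kantorovichCost c '' plans μ ν) (v : ℝ≥0∞) := by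
  have := isProbabilityMeasure_avg hn μ
  have : Nonempty Y := nonempty_of_isProbabilityMeasure ν
  let i₀ : Fin n := ⟨0, hn⟩
  let S := {P : ProbabilityMeasure (X × Y) | (P : Measure (X × Y)) ∈ plans μ ν}
  have hprob {π : Measure (X × Y)} (hπ : π ∈ plans μ ν) : IsProbabilityMeasure π :=
    ⟨by rw [← univ_prod_univ, hπ.1.1 _ .univ, measure_univ]⟩
  have hS : IsClosed S := by
    have : S = ⋂ i, {P : ProbabilityMeasure (X × Y) | (P : Measure (X × Y)).map Prod.fst = avg μ ∧
        ((P : Measure (X × Y)).withDensity ((μ i).rnDeriv (avg μ) ∘ Prod.fst)).map Prod.snd =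
          ν} := by
      ext P
      simp only [S, mem_ofPred_eq, mem_plans_iff hn, mem_iInter]
      exact ⟨fun h i => ⟨h.1, h.2 i⟩, fun h => ⟨(h i₀).1, fun i => (h i).2⟩⟩
    rw [this]
    exact isClosed_iInter fun i => isClosed_setOf_map_snd_withDensity_eq _
      (Measure.measurable_rnDeriv _ _) (Measure.lintegral_rnDeriv_lt_top _ _).ne ν
  have hcont : Continuous fun P : ProbabilityMeasure (X × Y) => kantorovichCost c P :=
    ProbabilityMeasure.continuous_lintegral_continuousMap (⟨c, hc⟩ : C(X × Y, ℝ≥0))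
  obtain ⟨P, hP, hmin⟩ := hS.isCompact.exists_isMinOn
    ⟨⟨(avg μ).prod ν, inferInstance⟩, prod_mem_plans hn μ ν⟩ hcont.continuousOn
  have hfin : kantorovichCost c P ≠ ∞ := by
    obtain ⟨C, hC⟩ := (isCompact_range hc).bddAbove
    have hle : kantorovichCost c P ≤ ∫⁻ _, (C : ℝ≥0∞) ∂(P : Measure (X × Y)) :=
      lintegral_mono fun p => ENNReal.coe_le_coe.2 (hC (mem_range_self p))
    exact (hle.trans_lt (by simp)).ne
  refine ⟨(kantorovichCost c P).toNNReal, ?_⟩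
  rw [ENNReal.coe_toNNReal hfin]
  refine ⟨⟨_, hP, rfl⟩, ?_⟩
  rintro _ ⟨π, hπ, rfl⟩
  exact hmin (show (⟨π, hprob hπ⟩ : ProbabilityMeasure (X × Y)) ∈ S from hπ)

/-- A simultaneous transport map induces a simultaneous transport plan of the same cost. -/
theorem exists_mem_plans_of_mem_transportMaps {n : ℕ} (hn : 1 ≤ n) (μ : Fin n → Measure X)
    [∀ i, IsProbabilityMeasure (μ i)] (ν : Measure Y) {c : X × Y → ℝ≥0} (hc : Measurable c)
    {T : X → Y} (hT : T ∈ transportMaps μ ν) :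
    ∃ π ∈ plans μ ν, kantorovichCost c π = mongeCost c μ T := by
  obtain ⟨hTm, hTν⟩ := hT
  have hg : Measurable fun x => (x, T x) := measurable_id.prodMk hTm
  refine ⟨(avg μ).map fun x => (x, T x), ⟨⟨fun A hA => ?_, fun B hB => ?_⟩,
    Kernel.deterministic T hTm, ⟨inferInstance, fun A B hA hB => ?_⟩, fun i B hB => ?_⟩, ?_⟩
  · rw [Measure.map_apply hg (hA.prod .univ)]
    congr 1
    ext x
    simp
  · have h0 : (n : ℝ≥0∞) ≠ 0 := by exact_mod_cast (by omega : n ≠ 0)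
    have hpre : (fun x => (x, T x)) ⁻¹' (univ ×ˢ B) = T ⁻¹' B := by
      ext x
      simp
    have hi (i : Fin n) : μ i (T ⁻¹' B) = ν B := by rw [← Measure.map_apply hTm hB, hTν]
    rw [Measure.map_apply hg (MeasurableSet.univ.prod hB), hpre]
    simp only [avg, Measure.smul_apply, Measure.finsetSum_apply, hi, Finset.sum_const,
      Finset.card_univ, Fintype.card_fin, nsmul_eq_mul, smul_eq_mul]
    rw [← mul_assoc, ENNReal.inv_mul_cancel h0 (ENNReal.natCast_ne_top n), one_mul]
  · rw [Measure.map_apply hg (hA.prod hB)]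
    simp only [Kernel.deterministic_apply, Measure.dirac_apply' _ hB]
    have hpre : (fun x => (x, T x)) ⁻¹' (A ×ˢ B) = T ⁻¹' B ∩ A := by
      ext x
      simp [and_comm]
    rw [hpre, ← Measure.restrict_apply (hTm hB), ← lintegral_indicator_one (hTm hB)]
    rfl
  · simp only [Kernel.deterministic_apply, Measure.dirac_apply' _ hB]
    rw [← hTν i, Measure.map_apply hTm hB, ← lintegral_indicator_one (hTm hB)]
    rfl
  · rw [kantorovichCost, lintegral_map hc.coe_nnreal_ennreal hg, mongeCost]

end SimultaneousOT

/-! ### Approximation of plans by maps -/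

/-- A compact metric space has a finite measurable partition of arbitrarily small mesh, given here
by its labelling function. -/
theorem exists_measurable_label_dist_lt {Z : Type*} [MetricSpace Z] [CompactSpace Z]
    [MeasurableSpace Z] [OpensMeasurableSpace Z] [Nonempty Z] {δ : ℝ} (hδ : 0 < δ) :
    ∃ (N : ℕ) (l : Z → Fin (N + 1)), Measurable l ∧ ∀ x y, l x = l y → dist x y < δ := by
  let e := TopologicalSpace.denseSeq Z
  obtain ⟨t, ht⟩ := isCompact_univ.elim_finite_subcover (fun k => Metric.ball (e k) (δ / 2))
    (fun k => Metric.isOpen_ball) fun x _ => by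
      obtain ⟨k, hk⟩ := (TopologicalSpace.denseRange_denseSeq Z).exists_dist_lt x (half_pos hδ)
      exact mem_iUnion.2 ⟨k, hk⟩
  let N := t.sup id
  have hnear (x : Z) : dist (e (SimpleFunc.nearestPtInd e N x)) x < δ / 2 := by
    obtain ⟨k, hkt, hk⟩ := mem_iUnion₂.1 (ht (mem_univ x))
    have h := SimpleFunc.edist_nearestPt_le e x (N := N) (Finset.le_sup (f := id) hkt)
    rw [edist_dist, edist_dist, ENNReal.ofReal_le_ofReal_iff dist_nonneg] at h
    exact h.trans_lt (by rw [dist_comm]; exact hk)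
  refine ⟨N, fun x => ⟨SimpleFunc.nearestPtInd e N x,
    Nat.lt_succ_of_le (SimpleFunc.nearestPtInd_le e N x)⟩, ?_, fun x y hxy => ?_⟩
  · refine measurable_to_countable' fun j => ?_
    convert (SimpleFunc.nearestPtInd e N).measurableSet_fiber j using 1
    ext x
    simp [Fin.ext_iff]
  · have hxy' : SimpleFunc.nearestPtInd e N x = SimpleFunc.nearestPtInd e N y :=
      congrArg Fin.val hxy
    have hx := hnear x
    have hy := hnear y
    rw [← hxy'] at hy
    linarith [dist_triangle_left x y (e (SimpleFunc.nearestPtInd e N x))]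

/-- A continuous function on a product of compact spaces is uniformly close to a function of finite
measurable labels of the two variables. -/
theorem exists_measurable_labels_of_continuous {X Y : Type*}
    [TopologicalSpace X] [CompactSpace X] [PolishSpace X] [MeasurableSpace X] [BorelSpace X]
    [TopologicalSpace Y] [CompactSpace Y] [PolishSpace Y] [MeasurableSpace Y] [BorelSpace Y]
    [Nonempty X] [Nonempty Y] {c : X × Y → ℝ≥0} (hc : Continuous c) {ε : ℝ≥0} (hε : 0 < ε) :
    ∃ (K N : ℕ) (k : X → Fin (K + 1)) (l : Y → Fin (N + 1)) (d : Fin (K + 1) × Fin (N + 1) → ℝ≥0),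
      Measurable k ∧ Measurable l ∧
        ∀ p, c p ≤ d (k p.1, l p.2) + ε ∧ d (k p.1, l p.2) ≤ c p + ε := by
  classical
  let _ := TopologicalSpace.upgradeIsCompletelyMetrizable X
  let _ := TopologicalSpace.upgradeIsCompletelyMetrizable Y
  obtain ⟨δ, hδ, hδc⟩ := Metric.uniformContinuous_iff.1
    (CompactSpace.uniformContinuous_of_continuous hc) ε hε
  obtain ⟨K, k, hk, hkδ⟩ := exists_measurable_label_dist_lt (Z := X) hδ
  obtain ⟨N, l, hl, hlδ⟩ := exists_measurable_label_dist_lt (Z := Y) hδ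
  let d (j : Fin (K + 1) × Fin (N + 1)) : ℝ≥0 :=
    if h : ∃ p : X × Y, (k p.1, l p.2) = j then c h.choose else 0
  refine ⟨K, N, k, l, d, hk, hl, fun p => ?_⟩
  have h : ∃ q : X × Y, (k q.1, l q.2) = (k p.1, l p.2) := ⟨p, rfl⟩
  have hd : d (k p.1, l p.2) = c h.choose := dif_pos h
  have hq := Prod.ext_iff.1 h.choose_spec
  have hdist : dist (c h.choose) (c p) < ε :=
    hδc (max_lt (hkδ _ _ hq.1) (hlδ _ _ hq.2))
  rw [hd]
  rw [NNReal.dist_eq, abs_lt] at hdist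
  constructor
  · rw [← NNReal.coe_le_coe, NNReal.coe_add]
    linarith
  · rw [← NNReal.coe_le_coe, NNReal.coe_add]
    linarith

namespace SimultaneousOT

variable {X Y : Type*} [MeasurableSpace X] [MeasurableSpace Y]

theorem measure_eq_sum_inter_preimage {m : ℕ} (μ : Measure X) {L : X → Fin m} (hL : Measurable L)
    (s : Set X) : μ s = ∑ l, μ (L ⁻¹' {l} ∩ s) := by
  have h := sum_measure_preimage_singleton (μ := μ.restrict s) Finset.univ (f := L)
    fun l _ => hL (measurableSet_singleton l)
  simp only [Measure.restrict_apply (hL (measurableSet_singleton _)), Finset.coe_univ,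
    preimage_univ, Measure.restrict_apply_univ] at h
  exact h.symm

/-- Every simultaneous transport plan is approximated in cost by a simultaneous transport map. The
conditional probabilities of the plan, restricted to finite partitions of `X` and `Y`, are replaced by
a choice of label, and the part of `X` with label `l` is transported onto the `l`-th cell of `Y`. -/
theorem exists_mem_transportMaps_mongeCost_le
    [TopologicalSpace X] [CompactSpace X] [PolishSpace X] [BorelSpace X]
    [TopologicalSpace Y] [CompactSpace Y] [PolishSpace Y] [BorelSpace Y]
    {c : X × Y → ℝ≥0} (hc : Continuous c) {n : ℕ} (hn : 1 ≤ n) (μ : Fin n → Measure X)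
    [∀ i, IsProbabilityMeasure (μ i)] (hμ : ∀ i, Atomless (μ i)) (ν : Measure Y)
    [IsProbabilityMeasure ν] {π : Measure (X × Y)} (hπ : π ∈ plans μ ν) {ε : ℝ≥0} (hε : 0 < ε) :
    ∃ T ∈ transportMaps μ ν, mongeCost c μ T ≤ kantorovichCost c π + ε := by
  have := isProbabilityMeasure_avg hn μ
  have : Nonempty X := nonempty_of_isProbabilityMeasure (avg μ)
  have : Nonempty Y := nonempty_of_isProbabilityMeasure ν
  have hπp : IsProbabilityMeasure π :=
    ⟨by rw [← univ_prod_univ, hπ.1.1 _ .univ, measure_univ]⟩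
  obtain ⟨-, κ, ⟨hκ, hπκ⟩, hκν⟩ := hπ
  obtain ⟨K, N, k, l, d, hk, hl, hd⟩ := exists_measurable_labels_of_continuous hc (half_pos hε)
  have hkm (j) : MeasurableSet (k ⁻¹' {j}) := hk (measurableSet_singleton j)
  have hlm (j) : MeasurableSet (l ⁻¹' {j}) := hl (measurableSet_singleton j)
  -- The label chosen at `x` has to have the right law under each `μ i`, on each cell of `X`.
  have hfin (j : Fin n ⊕ (Fin n × Fin (K + 1))) : IsFiniteMeasure
      (Sum.elim μ (fun ij : Fin n × Fin (K + 1) => (μ ij.1).restrict (k ⁻¹' {ij.2})) j) := by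
    rcases j with i | ij
    · exact inferInstanceAs (IsFiniteMeasure (μ i))
    · exact inferInstanceAs (IsFiniteMeasure ((μ ij.1).restrict _))
  obtain ⟨L, hL, hLμ⟩ := exists_measurable_label
    (Sum.elim μ fun ij : Fin n × Fin (K + 1) => (μ ij.1).restrict (k ⁻¹' {ij.2}))
    (by
      rintro (i | ij)
      · exact hμ i
      · exact (hμ ij.1).restrict (hkm ij.2))
    N (fun j x => κ x (l ⁻¹' {j})) (fun j => κ.measurable_coe (hlm j)) fun x => by
      rw [sum_measure_preimage_singleton _ fun j _ => hlm j]
      simp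
  have hLm (j) : MeasurableSet (L ⁻¹' {j}) := hL (measurableSet_singleton j)
  have hLν (i : Fin n) (j) : μ i (L ⁻¹' {j}) = ν (l ⁻¹' {j}) :=
    (hLμ (.inl i) j).trans (hκν i _ (hlm j))
  have hLk (i : Fin n) (a) (j) :
      μ i (L ⁻¹' {j} ∩ k ⁻¹' {a}) = ∫⁻ x in k ⁻¹' {a}, κ x (l ⁻¹' {j}) ∂(μ i) := by
    rw [← Measure.restrict_apply (hLm j)]
    exact hLμ (.inr (i, a)) j
  have hcell (j) := exists_measurable_map_eq_of_atomless (fun i => (μ i).restrict (L ⁻¹' {j}))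
    (fun i => (hμ i).restrict (hLm j)) (ν.restrict (l ⁻¹' {j}))
    fun i => by simp [hLν]
  choose S hS hSν using hcell
  let T (x : X) : Y := S (L x) x
  have hT : Measurable T :=
    (measurable_from_prod_countable_right (f := fun p : Fin (N + 1) × X => S p.1 p.2) hS).comp
      (hL.prodMk measurable_id)
  have hTS (i : Fin n) (j) {B : Set Y} (hB : MeasurableSet B) :
      μ i (L ⁻¹' {j} ∩ T ⁻¹' B) = ν (B ∩ l ⁻¹' {j}) := by
    rw [← Measure.restrict_apply hB, ← hSν j i, Measure.map_apply (hS j) hB,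
      Measure.restrict_apply (hS j hB)]
    congr 1
    ext x
    simp only [mem_inter_iff, mem_preimage, mem_singleton_iff, T]
    constructor
    · rintro ⟨rfl, h⟩
      exact ⟨h, rfl⟩
    · rintro ⟨h, rfl⟩
      exact ⟨rfl, h⟩
  refine ⟨T, ⟨hT, fun i => ?_⟩, ?_⟩
  · ext B hB
    rw [Measure.map_apply hT hB, measure_eq_sum_inter_preimage (μ i) hL,
      measure_eq_sum_inter_preimage ν hl]
    exact Finset.sum_congr rfl fun j _ => by rw [hTS i j hB, inter_comm]
  · have hlT : ∀ᵐ x ∂(avg μ), l (T x) = L x := by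
      have hi (i : Fin n) : μ i {x | ¬ l (T x) = L x} = 0 := by
        rw [measure_eq_sum_inter_preimage (μ i) hL]
        refine Finset.sum_eq_zero fun j _ => ?_
        have h := hTS i j (hlm j).compl
        rw [compl_inter_self, measure_empty] at h
        refine measure_mono_null ?_ h
        rintro x ⟨rfl, hx⟩
        exact ⟨rfl, hx⟩
      rw [ae_iff, avg, Measure.smul_apply, Measure.finsetSum_apply]
      simp [hi]
    have hkL : Measurable fun x => (k x, L x) := hk.prodMk hL
    have hkl : Measurable fun p : X × Y => (k p.1, l p.2) :=
      (hk.comp measurable_fst).prodMk (hl.comp measurable_snd)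
    -- The labels of `(x, T x)` and those of a pair distributed according to the plan have the same law.
    have hlaw : (avg μ).map (fun x => (k x, L x)) = π.map fun p => (k p.1, l p.2) := by
      refine Measure.ext_of_singleton fun ⟨a, j⟩ => ?_
      have h1 : (fun x => (k x, L x)) ⁻¹' {(a, j)} = L ⁻¹' {j} ∩ k ⁻¹' {a} := by
        ext x
        simp [and_comm]
      have h2 : (fun p : X × Y => (k p.1, l p.2)) ⁻¹' {(a, j)} = (k ⁻¹' {a}) ×ˢ (l ⁻¹' {j}) := by
        ext p
        simp
      rw [Measure.map_apply hkL (measurableSet_singleton _),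
        Measure.map_apply hkl (measurableSet_singleton _), h1, h2, hπκ _ _ (hkm a) (hlm j),
        ← lintegral_indicator (hkm a), avg, lintegral_smul_measure, lintegral_finsetSum_measure,
        Measure.smul_apply, Measure.finsetSum_apply]
      simp only [lintegral_indicator (hkm a), hLk]
    have hdm : Measurable fun j => (d j : ℝ≥0∞) := measurable_of_countable _
    have hhalf : ((ε / 2 : ℝ≥0) : ℝ≥0∞) + (ε / 2 : ℝ≥0) = ε := by
      rw [← ENNReal.coe_add, add_halves]
    calc mongeCost c μ T ≤ ∫⁻ x, ((d (k x, L x) : ℝ≥0∞) + (ε / 2 : ℝ≥0)) ∂(avg μ) := by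
          refine lintegral_mono_ae ?_
          filter_upwards [hlT] with x hx
          rw [← hx]
          exact_mod_cast (hd (x, T x)).1
      _ = (∫⁻ p, (d (k p.1, l p.2) : ℝ≥0∞) ∂π) + (ε / 2 : ℝ≥0) := by
          rw [lintegral_add_right _ measurable_const, ← lintegral_map hdm hkL, hlaw,
            lintegral_map hdm hkl]
          simp
      _ ≤ (∫⁻ p, ((c p : ℝ≥0∞) + (ε / 2 : ℝ≥0)) ∂π) + (ε / 2 : ℝ≥0) := by
          gcongr with p
          exact_mod_cast (hd p).2
      _ = kantorovichCost c π + ε := by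
          rw [lintegral_add_right _ measurable_const]
          simp only [lintegral_const, measure_univ, mul_one]
          rw [add_assoc, hhalf, kantorovichCost]

end SimultaneousOT

theorem mainTheorem1
    {X Y : Type*}
    [TopologicalSpace X] [CompactSpace X] [SouslinSpace X] [MeasurableSpace X] [BorelSpace X]
    [TopologicalSpace Y] [CompactSpace Y] [SouslinSpace Y] [MeasurableSpace Y] [BorelSpace Y]
    (c : X × Y → ℝ≥0) (hc : Continuous c)
    (n : ℕ) (hn : 1 ≤ n)
    (μ : Fin n → Measure X) (hμ : ∀ i, IsProbabilityMeasure (μ i))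
    (hμ' : ∀ i, SimultaneousOT.Atomless (μ i))
    (ν : Measure Y) (hν : IsProbabilityMeasure ν) (hν' : SimultaneousOT.Atomless ν) :
    ∃ v : ℝ≥0,
      IsLeast (SimultaneousOT.kantorovichCost c '' SimultaneousOT.plans μ ν) (v : ℝ≥0∞) ∧
      IsGLB (SimultaneousOT.mongeCost c μ '' SimultaneousOT.transportMaps μ ν) (v : ℝ≥0∞) := by
  have := SouslinSpace.polishSpace X
  have := SouslinSpace.polishSpace Y
  obtain ⟨v, hv⟩ := SimultaneousOT.exists_isLeast_kantorovichCost hc hn μ ν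
  refine ⟨v, hv, ?_, fun w hw => ?_⟩
  · rintro _ ⟨T, hT, rfl⟩
    obtain ⟨π, hπ, hcost⟩ :=
      SimultaneousOT.exists_mem_plans_of_mem_transportMaps hn μ ν hc.measurable hT
    exact hcost ▸ hv.2 ⟨π, hπ, rfl⟩
  · obtain ⟨π, hπ, hπv⟩ := hv.1
    refine ENNReal.le_of_forall_pos_le_add fun ε hε _ => ?_
    obtain ⟨T, hT, hle⟩ :=
      SimultaneousOT.exists_mem_transportMaps_mongeCost_le hc hn μ hμ' ν hπ hε
    rw [← hπv]
    exact (hw ⟨T, hT, rfl⟩).trans hle
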